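/- Let $S=\mathbb{C}[x,y,z]$ and $\mathfrak m=(x,y,z)$. For a reduced curve $C:f=0$ of degree $d$ in $\mathbb{P}^2$ ($f\in S$ homogeneous of degree $d$ without multiple factors), let $J_f=(f_x,f_y,f_z)$ be the Jacobian ideal, $I_f$ its saturation with respect to $\mathfrak m$, $N(f)=I_f/J_f$, $n(f)_j=\dim N(f)_j$ and $\nu(C)=\max_j n(f)_j$. Let $mdr(f)$ be the least $m\ge 0$ for which there is a nonzero triple $(a,b,c)$ of homogeneous polynomials of degree $m$ with $af_x+bf_y+cf_z=0$. The curve $C$ is free with exponents $(d_1,d_2)$ if $J_f=I_f$, $d_1=mdr(f)$ and $d_2=d-1-d_1$; it is nearly free with exponents $(d_1,d_2)$ if $\nu(C)=1$, $d_1=mdr(f)$ and $d_2=d-d_1$. Consider the tricuspidal quartic $\mathcal C_4$ and the rational cuspidal quintics $\mathcal C_5,\mathcal C_5',\mathcal C_5''$ in $\mathbb{P}^2$ which are the images of $\mathbb{P}^1$ under the parametrizations $$\mathcal C_4:\ (s:t)\mapsto(s^3t-\tfrac12 s^4:\ s^2t^2:\ t^4-2st^3),$$ $$\mathcal C_5:\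 (s:t)\mapsto(s^4t-\tfrac12 s^5:\ s^3t^2:\ -\tfrac32 st^4+t^5),$$ $$\mathcal C_5':\ (s:t)\mapsto(s^4t-s^5:\ s^2t^3-\tfrac5{32}s^5:\ -\tfrac{125}{128}s^5-\tfrac{25}{16}s^3t^2-5st^4+t^5),$$ $$\mathcal C_5'':\ (s:t)\mapsto(s^4t:\ s^2t^3-s^5:\ t^5+2s^3t^2).$$ Then $\mathcal C_4$ is nearly free with exponents $(2,2)$, and $\mathcal C_5$, $\mathcal C_5'$ and $\mathcal C_5''$ are free with exponents $(2,2)$. Moreover, after a projective linear change of coordinates, $\mathcal C_4$ becomes the reduced curve $$x^2y^2+y^2z^2+x^2z^2-2xyz(x+y+z)=0,$$ which is likewise nearly free with exponents $(2,2)$, and in the given coordinates $\mathcal C_5$ and $\mathcal C_5''$ have the reduced equations $$\mathcal C_5:\ 9xy^4-4y^5-24x^2y^2z+48xy^3z-16y^4z+16x^3z^2=0,$$ $$\mathcal C_5'':\ -27x^5+2x^2y^3-18x^3yz+y^4z-2xy^2z^2+x^2z^3=0.$$ -/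

import Mathlib

namespace PlaneCurve

/-- The polynomial ring `S = ℂ[x, y, z]`, with `x = X 0`, `y = X 1`, `z = X 2`. -/
abbrev S : Type := MvPolynomial (Fin 3) ℂ

/-- The complex projective plane. -/
abbrev P2 : Type := Projectivization ℂ (Fin 3 → ℂ)

section Jacobian

/-- The partial derivatives `f_x, f_y, f_z`. -/
noncomputable def grad (f : S) (i : Fin 3) : S := MvPolynomial.pderiv i f

/-- The Jacobian ideal `J_f = (f_x, f_y, f_z)`. -/
noncomputable def jacobianIdeal (f : S) : Ideal S := Ideal.span (Set.range (grad f))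

/-- The maximal ideal `𝔪 = (x, y, z)`. -/
noncomputable def irrelevantIdeal : Ideal S :=
  Ideal.span (Set.range (MvPolynomial.X : Fin 3 → S))

/-- The saturation `{g | 𝔪 ^ k g ⊆ J for some k}` of an ideal `J` with respect to `𝔪`. -/
noncomputable def saturation (J : Ideal S) : Ideal S where
  carrier := {g | ∃ k : ℕ, ∀ h ∈ irrelevantIdeal ^ k, h * g ∈ J}
  zero_mem' := ⟨0, fun h _ => by simp⟩
  add_mem' := by
    rintro a b ⟨k, hk⟩ ⟨l, hl⟩
    refine ⟨max k l, fun h hh => ?_⟩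
    rw [mul_add]
    exact J.add_mem (hk h (Ideal.pow_le_pow_right (le_max_left k l) hh))
      (hl h (Ideal.pow_le_pow_right (le_max_right k l) hh))
  smul_mem' := by
    rintro c a ⟨k, hk⟩
    refine ⟨k, fun h hh => ?_⟩
    rw [smul_eq_mul, mul_left_comm]
    exact J.mul_mem_left c (hk h hh)

/-- The graded piece `N(f)_j` of the Jacobian module `N(f) = I_f / J_f`, where `I_f` is the
saturation of `J_f`, realized inside the Milnor algebra `M(f) = S / J_f`. -/
noncomputable def jacobianModulePiece (f : S) (j : ℕ) : Submodule ℂ (S ⧸ jacobianIdeal f) :=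
  Submodule.map (Ideal.Quotient.mkₐ ℂ (jacobianIdeal f)).toLinearMap
    ((saturation (jacobianIdeal f)).restrictScalars ℂ ⊓
      MvPolynomial.homogeneousSubmodule (Fin 3) ℂ j)

/-- `n(f)_j = dim N(f)_j`. -/
noncomputable def nDim (f : S) (j : ℕ) : ℕ := Module.finrank ℂ (jacobianModulePiece f j)

/-- `ν = max_j n(f)_j`. -/
noncomputable def nu (f : S) : ℕ∞ := ⨆ j : ℕ, (nDim f j : ℕ∞)

/-- The module `AR(f)` of all Jacobian relations `a f_x + b f_y + c f_z = 0`. -/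
noncomputable def jacobianRelations (f : S) : Submodule S (Fin 3 → S) :=
  LinearMap.ker (Fintype.linearCombination S (grad f))

/-- `AR(f)_k`: the relations whose three entries are homogeneous of degree `k`. -/
noncomputable def jacobianRelationsPiece (f : S) (k : ℕ) : Submodule ℂ (Fin 3 → S) :=
  (jacobianRelations f).restrictScalars ℂ ⊓
    Submodule.pi Set.univ (fun _ => MvPolynomial.homogeneousSubmodule (Fin 3) ℂ k)

/-- `ar(f)_k = dim AR(f)_k`. -/
noncomputable def arDim (f : S) (k : ℕ) : ℕ := Module.finrank ℂ (jacobianRelationsPiece f k)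

/-- `mdr(f)`: the smallest `m` with `ar(f)_m > 0`. -/
noncomputable def mdr (f : S) : ℕ := sInf {m : ℕ | 0 < arDim f m}

end Jacobian

section Curves

/-- The zero set in the projective plane of a (homogeneous) polynomial. -/
def zeroSet (f : S) : Set P2 := {p | MvPolynomial.eval p.rep f = 0}

/-- `C : f = 0` is a reduced plane curve of degree `d`: `f` is homogeneous of degree `d`, has no
multiple factors, and its zero set is `C`. -/
structure IsReducedEquation (C : Set P2) (d : ℕ) (f : S) : Prop where
  isHomogeneous : f.IsHomogeneous d
  squarefree : Squarefree f
  zeroSet_eq : zeroSet f = C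

/-- `C : f = 0` is a free curve with exponents `(d₁, d₂)`: one has `J_f = I_f`, `d₁ = mdr(f)` and
`d₂ = d - 1 - d₁`. The reduced equation `f` of `C` is unique up to a nonzero constant factor. -/
def IsFreeWithExponents (C : Set P2) (d₁ d₂ : ℕ) : Prop :=
  ∃ (d : ℕ) (f : S), IsReducedEquation C d f ∧
    saturation (jacobianIdeal f) = jacobianIdeal f ∧ mdr f = d₁ ∧ d₁ + d₂ + 1 = d

/-- `C : f = 0` is a nearly free curve with exponents `(d₁, d₂)`: one has `ν = 1`, `d₁ = mdr(f)`
and `d₂ = d - d₁`. The reduced equation `f` of `C` is unique up to a nonzero constant factor. -/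
def IsNearlyFreeWithExponents (C : Set P2) (d₁ d₂ : ℕ) : Prop :=
  ∃ (d : ℕ) (f : S), IsReducedEquation C d f ∧ nu f = 1 ∧ mdr f = d₁ ∧ d₁ + d₂ = d

/-- Projective equivalence: some projective linear automorphism of the plane maps `C` onto `D`. -/
def ProjectivelyEquivalent (C D : Set P2) : Prop :=
  ∃ e : (Fin 3 → ℂ) ≃ₗ[ℂ] (Fin 3 → ℂ),
    Projectivization.map e.toLinearMap e.injective '' C = D

/-- The set of all points `φ(s, t)` of the plane. (For the parametrizations below, `φ(s, t)` is
zero only for `s = t = 0`.) -/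
def parametrized (φ : ℂ → ℂ → Fin 3 → ℂ) : Set P2 :=
  {p | ∃ (s t : ℂ) (h : φ s t ≠ 0), p = Projectivization.mk ℂ (φ s t) h}

/-- The tricuspidal quartic `𝒞₄`. -/
noncomputable def quartic : Set P2 :=
  parametrized fun s t =>
    ![s ^ 3 * t - 1 / 2 * s ^ 4, s ^ 2 * t ^ 2, t ^ 4 - 2 * s * t ^ 3]

/-- The quintic `𝒞₅`, with cusps of types `E₆, A₄, A₂`. -/
noncomputable def quintic : Set P2 :=
  parametrized fun s t =>
    ![s ^ 4 * t - 1 / 2 * s ^ 5, s ^ 3 * t ^ 2, -(3 / 2) * s * t ^ 4 + t ^ 5]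

/-- The quintic `𝒞₅'`, with three cusps of type `A₄`. -/
noncomputable def quintic' : Set P2 :=
  parametrized fun s t =>
    ![s ^ 4 * t - s ^ 5,
      s ^ 2 * t ^ 3 - 5 / 32 * s ^ 5,
      -(125 / 128) * s ^ 5 - 25 / 16 * s ^ 3 * t ^ 2 - 5 * s * t ^ 4 + t ^ 5]

/-- The quintic `𝒞₅''`, with cusps of types `A₆, A₂, A₂, A₂`. -/
noncomputable def quintic'' : Set P2 :=
  parametrized fun s t =>
    ![s ^ 4 * t, s ^ 2 * t ^ 3 - s ^ 5, t ^ 5 + 2 * s ^ 3 * t ^ 2]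

end Curves

section Equations

open MvPolynomial

/-- `x²y² + y²z² + x²z² - 2xyz(x + y + z)` -/
noncomputable def quarticEq : S :=
  X 0 ^ 2 * X 1 ^ 2 + X 1 ^ 2 * X 2 ^ 2 + X 0 ^ 2 * X 2 ^ 2
    - 2 * X 0 * X 1 * X 2 * (X 0 + X 1 + X 2)

/-- `9xy⁴ - 4y⁵ - 24x²y²z + 48xy³z - 16y⁴z + 16x³z²` -/
noncomputable def quinticEq : S :=
  9 * X 0 * X 1 ^ 4 - 4 * X 1 ^ 5 - 24 * X 0 ^ 2 * X 1 ^ 2 * X 2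
    + 48 * X 0 * X 1 ^ 3 * X 2 - 16 * X 1 ^ 4 * X 2 + 16 * X 0 ^ 3 * X 2 ^ 2

/-- `-27x⁵ + 2x²y³ - 18x³yz + y⁴z - 2xy²z² + x²z³` -/
noncomputable def quinticEq'' : S :=
  -27 * X 0 ^ 5 + 2 * X 0 ^ 2 * X 1 ^ 3 - 18 * X 0 ^ 3 * X 1 * X 2
    + X 1 ^ 4 * X 2 - 2 * X 0 * X 1 ^ 2 * X 2 ^ 2 + X 0 ^ 2 * X 2 ^ 3

end Equations

end PlaneCurve

/-!
For a plane curve `f = 0`, suppose that the partial derivatives of `f` are, up to a common constant,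
the signed maximal minors of a `3 × 2` matrix of forms. By the Hilbert–Burch theorem, which for
minors without common factor is Cramer's rule, they have no other syzygies than the combinations of
its columns, and the ideal they generate is saturated; so the curve is free. For a quartic with a
`4 × 3` matrix of linear forms, whose last row is `(x, y, z)`, and whose first three minors are the
partial derivatives, the fourth minor is a cubic that spans `N(f)`, and the curve is nearly free.

A parametrized curve is matched with its equation by solving for the parameter: in the chart
`x = 1`, the second coordinate is an equation for `t` of degree two or three over `ℂ[y]`, modulo
which the third coordinate is a polynomial in `t` whose characteristic polynomial is the equation
of the curve.
-/

namespace PlaneCurve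

open MvPolynomial Matrix

section HilbertBurch

variable {R : Type*} [CommRing R]

/-- The elements `D i` have no common divisor besides units. -/
def NoCommonFactor {ι : Type*} (D : ι → R) : Prop := ∀ g, (∀ i, g ∣ D i) → IsUnit g

lemma NoCommonFactor.exists_ne_zero [Nontrivial R] {ι : Type*} {D : ι → R}
    (hD : NoCommonFactor D) : ∃ i, D i ≠ 0 := by
  by_contra! h
  exact not_isUnit_zero (hD 0 fun i => (h i).symm ▸ dvd_rfl)

lemma NoCommonFactor.dvd_of_mul_eq_mul [IsDomain R] [UniqueFactorizationMonoid R] {ι : Type*}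
    [Finite ι] {D a : ι → R} (hD : NoCommonFactor D) (h : ∀ i k, D k * a i = D i * a k) (i : ι) :
    D i ∣ a i := by
  classical
  let := Fintype.ofFinite ι
  let := (inferInstance : Nonempty (NormalizationMonoid R)).some
  let := UniqueFactorizationMonoid.toNormalizedGCDMonoid R
  have hdvd : D i ∣ Finset.univ.gcd fun k => a i * D k :=
    Finset.dvd_gcd fun k _ => ⟨a k, by rw [mul_comm, h]⟩
  have hunit : IsUnit (Finset.univ.gcd D) := hD _ fun k => Finset.gcd_dvd (Finset.mem_univ k)
  exact hunit.dvd_mul_right.1 (hdvd.trans (Finset.gcd_mul_left' _ D (a i)).dvd)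

lemma mem_span_range_iff_exists_dotProduct {ι : Type*} [Fintype ι] {D : ι → R} {g : R} :
    g ∈ Ideal.span (Set.range D) ↔ ∃ a, D ⬝ᵥ a = g := by
  simp only [Ideal.mem_span_range_iff_exists_fun, dotProduct, mul_comm]

variable {n : ℕ}

/-- The maximal minor of `M` that omits row `i`, with the sign for which the signed minors are
orthogonal to the columns. -/
def signedMinor (M : Matrix (Fin (n + 1)) (Fin n) R) (i : Fin (n + 1)) : R :=
  (-1) ^ (i : ℕ) * (M.submatrix i.succAbove id).det

variable (M : Matrix (Fin (n + 1)) (Fin n) R)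

lemma signedMinor_vecMul : signedMinor M ᵥ* M = 0 := by
  ext l
  let N : Matrix (Fin (n + 1)) (Fin (n + 1)) R := of fun i => Fin.cons (M i l) (M i)
  have hN : N.det = 0 := det_zero_of_column_eq (Fin.succ_ne_zero l).symm fun i => by simp [N]
  rw [vecMul, dotProduct, Pi.zero_apply, ← hN, det_succ_column_zero]
  refine Finset.sum_congr rfl fun i _ => ?_
  have hsub : N.submatrix i.succAbove Fin.succ = M.submatrix i.succAbove id := by
    ext; simp [N]
  rw [hsub, signedMinor]
  simp only [N, of_apply, Fin.cons_zero]
  ring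

lemma signedMinor_dotProduct_mulVec (b : Fin n → R) : signedMinor M ⬝ᵥ M *ᵥ b = 0 := by
  rw [dotProduct_mulVec, signedMinor_vecMul, zero_dotProduct]

variable {M} in
lemma mem_of_mulVec_mem {I : Ideal R} (hI : I.IsPrime) {i : Fin (n + 1)} (hi : signedMinor M i ∉ I)
    {b : Fin n → R} (hb : ∀ j, (M *ᵥ b) j ∈ I) (l : Fin n) : b l ∈ I := by
  set A := M.submatrix i.succAbove id
  have hadj : A.adjugate *ᵥ (A *ᵥ b) = A.det • b := by
    rw [mulVec_mulVec, adjugate_mul, smul_mulVec, one_mulVec]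
  have hmem : (A.det • b) l ∈ I := by
    rw [← hadj]
    exact I.sum_mem (t := Finset.univ) fun j _ => I.mul_mem_left _ (hb (i.succAbove j))
  exact (hI.mem_or_mem hmem).resolve_left fun h => hi (I.mul_mem_left _ h)

variable [IsDomain R]

lemma mulVec_injective_of_signedMinor_ne_zero {i : Fin (n + 1)} (hi : signedMinor M i ≠ 0) :
    Function.Injective M.mulVec := by
  refine (injective_iff_map_eq_zero M.mulVecLin).2 fun b hb => funext fun l => ?_
  exact Ideal.mem_bot.1 <| mem_of_mulVec_mem Ideal.isPrime_bot hi
    (fun j => Ideal.mem_bot.2 (congrFun hb j)) l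

lemma exists_mulVec_eq_signedMinor_smul {a : Fin (n + 1) → R} (ha : signedMinor M ⬝ᵥ a = 0)
    (i : Fin (n + 1)) : ∃ b, M *ᵥ b = signedMinor M i • a := by
  by_cases hi : signedMinor M i = 0
  · exact ⟨0, by rw [mulVec_zero, hi, zero_smul]⟩
  set A := M.submatrix i.succAbove id
  set b := (-1 : R) ^ (i : ℕ) • A.adjugate *ᵥ (a ∘ i.succAbove) with hb
  set e := M *ᵥ b - signedMinor M i • a
  have hoff (j : Fin n) : e (i.succAbove j) = 0 := by
    have hA : A *ᵥ b = signedMinor M i • (a ∘ i.succAbove) := by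
      rw [hb, mulVec_smul, mulVec_mulVec, mul_adjugate, smul_mulVec, one_mulVec, smul_smul]
      rfl
    exact sub_eq_zero.2 (congrFun hA j)
  have hdiag : e i = 0 := by
    have horth : signedMinor M ⬝ᵥ e = 0 := by
      rw [dotProduct_sub, dotProduct_smul, signedMinor_dotProduct_mulVec, ha, smul_zero, sub_zero]
    rw [dotProduct, Fin.sum_univ_succAbove _ i] at horth
    simp only [hoff, mul_zero, Finset.sum_const_zero, add_zero] at horth
    exact (mul_eq_zero.1 horth).resolve_left hi
  exact ⟨b, sub_eq_zero.1 <| funext <| (Fin.forall_iff_succAbove i).2 ⟨hdiag, hoff⟩⟩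

variable {M} [UniqueFactorizationMonoid R]

theorem exists_mulVec_eq_of_signedMinor_dotProduct_eq_zero (hM : NoCommonFactor (signedMinor M))
    {a : Fin (n + 1) → R} (ha : signedMinor M ⬝ᵥ a = 0) : ∃ b, M *ᵥ b = a := by
  choose b hb using exists_mulVec_eq_signedMinor_smul M ha
  obtain ⟨i, hi⟩ := hM.exists_ne_zero
  have hcross (j k) : signedMinor M k • b j = signedMinor M j • b k := by
    apply mulVec_injective_of_signedMinor_ne_zero M hi
    rw [mulVec_smul, mulVec_smul, hb, hb, smul_comm]
  have hdvd (l : Fin n) : signedMinor M i ∣ b i l :=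
    hM.dvd_of_mul_eq_mul (a := fun k => b k l) (fun j k => congrFun (hcross j k) l) i
  choose c hc using hdvd
  have hbc : b i = signedMinor M i • c := funext hc
  refine ⟨c, smul_right_injective _ hi ?_⟩
  simp only [← hb, hbc, mulVec_smul]

/-- If `p g = D ⬝ a` and `q g = D ⬝ b`, then `q a - p b` is a syzygy `M c` with `c ≡ 0` modulo
`(p, q)`, say `c = p v + q w`; hence `p` divides `a - M w`, and `g = D ⬝ (a - M w) / p`. -/
lemma mem_span_signedMinor_of_mul_mem (hM : NoCommonFactor (signedMinor M)) {p q : R}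
    (hp : Prime p) (hpq : ¬ p ∣ q) (hI : (Ideal.span {p, q}).IsPrime) {i : Fin (n + 1)}
    (hi : signedMinor M i ∉ Ideal.span {p, q}) {g : R}
    (hpg : p * g ∈ Ideal.span (Set.range (signedMinor M)))
    (hqg : q * g ∈ Ideal.span (Set.range (signedMinor M))) :
    g ∈ Ideal.span (Set.range (signedMinor M)) := by
  rw [mem_span_range_iff_exists_dotProduct] at hpg hqg ⊢
  obtain ⟨a, ha⟩ := hpg
  obtain ⟨b, hb⟩ := hqg
  obtain ⟨c, hc⟩ : ∃ c, M *ᵥ c = q • a - p • b := by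
    refine exists_mulVec_eq_of_signedMinor_dotProduct_eq_zero hM ?_
    rw [dotProduct_sub, dotProduct_smul, dotProduct_smul, ha, hb, smul_eq_mul, smul_eq_mul,
      mul_left_comm, sub_self]
  have hcI : ∀ l, c l ∈ Ideal.span {p, q} := mem_of_mulVec_mem hI hi fun j =>
    Ideal.mem_span_pair.2 ⟨-b j, a j, by
      rw [hc, Pi.sub_apply, Pi.smul_apply, Pi.smul_apply, smul_eq_mul, smul_eq_mul]; ring⟩
  simp only [Ideal.mem_span_pair] at hcI
  choose v w hvw using hcI
  have hMvw (j) : p * (M *ᵥ v) j + q * (M *ᵥ w) j = q * a j - p * b j := by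
    have hcvw : c = p • v + q • w := funext fun l => by
      rw [← hvw, Pi.add_apply, Pi.smul_apply, Pi.smul_apply, smul_eq_mul, smul_eq_mul,
        mul_comm p, mul_comm q]
    rw [hcvw, mulVec_add, mulVec_smul, mulVec_smul] at hc
    exact congrFun hc j
  have hdvd (j) : p ∣ (a - M *ᵥ w) j :=
    (hp.dvd_or_dvd ⟨b j + (M *ᵥ v) j, by
      rw [Pi.sub_apply]; linear_combination -hMvw j⟩).resolve_left hpq
  choose e he using hdvd
  refine ⟨e, mul_left_cancel₀ hp.ne_zero ?_⟩
  calc p * (signedMinor M ⬝ᵥ e) = signedMinor M ⬝ᵥ (a - M *ᵥ w) := by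
        rw [show a - M *ᵥ w = p • e from funext he, dotProduct_smul, smul_eq_mul]
    _ = p * g := by rw [dotProduct_sub, ha, signedMinor_dotProduct_mulVec, sub_zero]

end HilbertBurch

section Saturation

lemma le_saturation (J : Ideal S) : J ≤ saturation J :=
  fun _ hg => ⟨0, fun h _ => J.mul_mem_left h hg⟩

lemma saturation_mono {J K : Ideal S} (hJK : J ≤ K) : saturation J ≤ saturation K :=
  fun _ ⟨k, hk⟩ => ⟨k, fun h hh => hJK (hk h hh)⟩

lemma saturation_eq_self {J : Ideal S} (hJ : ∀ g, (∀ m, X m * g ∈ J) → g ∈ J) :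
    saturation J = J := by
  refine le_antisymm ?_ (le_saturation J)
  rintro g ⟨k, hk⟩
  induction k with
  | zero => simpa only [one_mul] using hk 1 (by simp)
  | succ k ih =>
    refine ih fun h hh => hJ _ fun m => ?_
    rw [← mul_assoc]
    exact hk _ (pow_succ' irrelevantIdeal k ▸ Ideal.mul_mem_mul (Ideal.subset_span ⟨m, rfl⟩) hh)

lemma eq_ker_of_X_sub_mem {σ k : Type*} [CommRing k] {I : Ideal (MvPolynomial σ k)}
    (ψ : MvPolynomial σ k →ₐ[k] MvPolynomial σ k) (hψ : ∀ m, X m - ψ (X m) ∈ I)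
    (hI : I ≤ RingHom.ker ψ) : I = RingHom.ker ψ := by
  refine le_antisymm hI fun g hg => ?_
  have hcomp : (Ideal.Quotient.mkₐ k I).comp ψ = Ideal.Quotient.mkₐ k I :=
    algHom_ext fun m => (Ideal.Quotient.eq.2 (hψ m)).symm
  have hmk : Ideal.Quotient.mk I (ψ g) = Ideal.Quotient.mk I g := DFunLike.congr_fun hcomp g
  rw [hg, map_zero] at hmk
  exact Ideal.Quotient.eq_zero_iff_mem.1 hmk.symm

lemma span_X_sub_pair_eq_ker (y z : ℂ) :
    Ideal.span {X 1 - C y * X 0, X 2 - C z * X 0} =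
      RingHom.ker (aeval ![X 0, C y * X 0, C z * X 0] : S →ₐ[ℂ] S) := by
  refine eq_ker_of_X_sub_mem _ (fun m => ?_) (Ideal.span_le.2 ?_)
  · fin_cases m
    · simp
    · simpa using Ideal.subset_span (by simp)
    · simpa using Ideal.subset_span (by simp)
  · rintro g (rfl | rfl) <;> simp [RingHom.mem_ker]

lemma prime_X_one_sub (y : ℂ) : Prime (X 1 - C y * X 0 : S) := by
  have hker : Ideal.span {X 1 - C y * X 0} =
      RingHom.ker (aeval ![X 0, C y * X 0, X 2] : S →ₐ[ℂ] S) := by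
    refine eq_ker_of_X_sub_mem _ (fun m => by fin_cases m <;> simp) (Ideal.span_le.2 ?_)
    rintro g rfl
    simp [RingHom.mem_ker]
  refine (Ideal.span_singleton_prime fun h => ?_).1 (hker ▸ RingHom.ker_isPrime _)
  simpa using congrArg (eval ![0, 1, 0]) h

lemma not_X_one_sub_dvd_X_two_sub (y z : ℂ) : ¬ (X 1 - C y * X 0 : S) ∣ X 2 - C z * X 0 :=
  fun h => by simpa using map_dvd (eval ![0, 0, 1]) h

theorem saturation_span_signedMinor {n : ℕ} {M : Matrix (Fin (n + 1)) (Fin n) S}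
    (hM : NoCommonFactor (signedMinor M)) :
    saturation (Ideal.span (Set.range (signedMinor M))) =
      Ideal.span (Set.range (signedMinor M)) := by
  obtain ⟨i, hi⟩ := hM.exists_ne_zero
  obtain ⟨P, hP⟩ : ∃ P, eval P (X 0 * signedMinor M i) ≠ 0 := by
    by_contra! h
    exact mul_ne_zero (X_ne_zero 0) hi (funext fun P => (h P).trans (map_zero _).symm)
  rw [map_mul, eval_X, mul_ne_zero_iff] at hP
  have hker := span_X_sub_pair_eq_ker (P 1 / P 0) (P 2 / P 0)
  set ψ : S →ₐ[ℂ] S := aeval ![X 0, C (P 1 / P 0) * X 0, C (P 2 / P 0) * X 0] with hψ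
  have hevalψ (g : S) : eval P (ψ g) = eval P g := by
    have hcomp : (aeval P).comp ψ = (aeval P : S →ₐ[ℂ] ℂ) :=
      algHom_ext fun m => by fin_cases m <;> simp [hψ, hP.1]
    simpa only [AlgHom.comp_apply, aeval_eq_eval, coe_aeval_eq_eval] using
      DFunLike.congr_fun hcomp g
  refine saturation_eq_self fun g hg => ?_
  have hlin (m : Fin 3) (c : ℂ) :
      (X m - C c * X 0) * g ∈ Ideal.span (Set.range (signedMinor M)) := by
    rw [sub_mul, mul_assoc]
    exact sub_mem (hg m) (Ideal.mul_mem_left _ _ (hg 0))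
  refine mem_span_signedMinor_of_mul_mem hM (prime_X_one_sub _) (not_X_one_sub_dvd_X_two_sub _ _)
    (hker ▸ RingHom.ker_isPrime ψ) (i := i) (fun hmem => hP.2 ?_) (hlin 1 _) (hlin 2 _)
  rw [hker, RingHom.mem_ker] at hmem
  rw [← hevalψ, hmem, map_zero]

end Saturation

section JacobianRelations

lemma mem_irrelevantIdeal_pow {n : ℕ} {p : S} (hp : p.IsHomogeneous n) : p ∈ irrelevantIdeal ^ n :=
  (mem_pow_idealOfVars_iff n p).2 fun _ hx => (hp.degree_eq_sum_deg_support hx).le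

lemma mem_irrelevantIdeal_iff {p : S} : p ∈ irrelevantIdeal ↔ constantCoeff p = 0 := by
  rw [constantCoeff_eq, ← pow_one irrelevantIdeal]
  refine (mem_pow_idealOfVars_iff' 1 p).trans ?_
  simp only [Nat.lt_one_iff, Finsupp.degree_eq_zero_iff, forall_eq]

lemma mem_irrelevantIdeal_of_X_dotProduct_eq_zero {b : Fin 3 → S} (hb : X ⬝ᵥ b = 0) (l : Fin 3) :
    b l ∈ irrelevantIdeal := by
  have hl := congrArg (fun p => constantCoeff (pderiv l p)) hb
  simpa [mem_irrelevantIdeal_iff, dotProduct, pderiv_X, Pi.single_apply, apply_ite] using hl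

lemma eq_zero_of_mem_irrelevantIdeal_pow {n k : ℕ} {p : S} (hp : p.IsHomogeneous k) (hkn : k < n)
    (hmem : p ∈ irrelevantIdeal ^ n) : p = 0 := by
  by_contra hp0
  obtain ⟨x, hx⟩ := support_nonempty.2 hp0
  exact hkn.not_ge <| hp.degree_eq_sum_deg_support hx ▸ (mem_pow_idealOfVars_iff n p).1 hmem x hx

lemma isHomogeneous_det {σ k ι : Type*} [CommRing k] [Fintype ι] [DecidableEq ι] {d : ι → ℕ}
    {A : Matrix ι ι (MvPolynomial σ k)} (hA : ∀ i l, (A i l).IsHomogeneous (d l)) :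
    A.det.IsHomogeneous (∑ l, d l) := by
  rw [det_apply]
  refine IsHomogeneous.sum _ _ _ fun s _ => ?_
  rw [Units.smul_def, zsmul_eq_mul, ← map_intCast (C : k →+* _)]
  exact (IsHomogeneous.prod _ _ d fun l _ => hA _ l).C_mul _

lemma mem_jacobianRelationsPiece {f : S} {k : ℕ} {a : Fin 3 → S} :
    a ∈ jacobianRelationsPiece f k ↔ grad f ⬝ᵥ a = 0 ∧ ∀ i, (a i).IsHomogeneous k := by
  simp [jacobianRelationsPiece, jacobianRelations, Fintype.linearCombination_apply, dotProduct,
    mul_comm, Submodule.mem_pi]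

lemma arDim_pos_iff {f : S} {k : ℕ} :
    0 < arDim f k ↔ ∃ a ∈ jacobianRelationsPiece f k, a ≠ 0 := by
  have hfin : Module.Finite ℂ (jacobianRelationsPiece f k) := by
    have : Module.Finite ℂ (Submodule.pi Set.univ
        (fun _ : Fin 3 => homogeneousSubmodule (Fin 3) ℂ k)) :=
      Module.Finite.iff_fg.2 (Submodule.fg_pi fun _ => homogeneousSubmodule_fg _ _ k)
    exact Submodule.finiteDimensional_of_le inf_le_right
  rw [arDim, Module.finrank_pos_iff, Submodule.nontrivial_iff_ne_bot, Submodule.ne_bot_iff]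

lemma mdr_eq {f : S} {k : ℕ} {a : Fin 3 → S} (ha : a ∈ jacobianRelationsPiece f k) (ha0 : a ≠ 0)
    (hlow : ∀ b : Fin 3 → S, grad f ⬝ᵥ b = 0 → ∀ i, b i ∈ irrelevantIdeal ^ k) : mdr f = k := by
  have hk : 0 < arDim f k := arDim_pos_iff.2 ⟨a, ha, ha0⟩
  refine le_antisymm (Nat.sInf_le hk) (le_csInf ⟨k, hk⟩ fun j hj => ?_)
  obtain ⟨b, hb, hb0⟩ := arDim_pos_iff.1 hj
  rw [mem_jacobianRelationsPiece] at hb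
  by_contra! hjk
  exact hb0 <| funext fun i => eq_zero_of_mem_irrelevantIdeal_pow (hb.2 i) hjk (hlow b hb.1 i)

end JacobianRelations

section FreeCurves

lemma NoCommonFactor.of_eq_smul {ι κ : Type*} {D : ι → S} {E : κ → S} (hD : NoCommonFactor D)
    {c : ℂ} (hc : c ≠ 0) (φ : ι → κ) (hE : ∀ i, E (φ i) = c • D i) : NoCommonFactor E :=
  fun g hg => hD g fun i => by
    rw [← inv_smul_smul₀ hc (D i), ← hE]
    exact dvd_smul_of_dvd _ (hg (φ i))

lemma span_range_smul {ι : Type*} (D : ι → S) {c : ℂ} (hc : c ≠ 0) :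
    Ideal.span (Set.range (c • D)) = Ideal.span (Set.range D) := by
  have hle (E : ι → S) (e : ℂ) : Ideal.span (Set.range (e • E)) ≤ Ideal.span (Set.range E) :=
    Ideal.span_le.2 <| Set.range_subset_iff.2 fun i =>
      Submodule.smul_of_tower_mem _ e (Ideal.subset_span ⟨i, rfl⟩)
  exact le_antisymm (hle D c) (by simpa only [inv_smul_smul₀ hc] using hle (c • D) c⁻¹)

lemma squarefree_of_noCommonFactor_grad {f : S} (hf : NoCommonFactor (grad f)) : Squarefree f := by
  rintro g ⟨h, rfl⟩
  refine hf g fun i => ⟨pderiv i g * h * 2 + g * pderiv i h, ?_⟩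
  simp only [grad, Derivation.leibniz, smul_eq_mul]
  ring

/-- Saito's criterion. -/
theorem isFreeWithExponents_of_signedMinor_eq_smul_grad {C : Set P2} {f : S} {d₁ d₂ : ℕ}
    (hC : IsReducedEquation C (d₁ + d₂ + 1) f) (hf : NoCommonFactor (grad f)) (hd : d₁ ≤ d₂)
    {M : Matrix (Fin 3) (Fin 2) S} (hM₁ : ∀ i, (M i 0).IsHomogeneous d₁)
    (hM₂ : ∀ i, (M i 1).IsHomogeneous d₂) {c : ℂ} (hc : c ≠ 0)
    (hM : signedMinor M = c • grad f) : IsFreeWithExponents C d₁ d₂ := by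
  have hgrad : grad f = c⁻¹ • signedMinor M := by rw [hM, inv_smul_smul₀ hc]
  have hMf : NoCommonFactor (signedMinor M) := hf.of_eq_smul hc id (congrFun hM)
  have hJ : jacobianIdeal f = Ideal.span (Set.range (signedMinor M)) := by
    rw [hM, span_range_smul _ hc, jacobianIdeal]
  refine ⟨_, f, hC, hJ ▸ saturation_span_signedMinor hMf, ?_, rfl⟩
  obtain ⟨i, hi⟩ := hMf.exists_ne_zero
  refine mdr_eq (a := M *ᵥ Pi.single 0 1) ?_ ?_ fun b hb i => ?_
  · refine mem_jacobianRelationsPiece.2 ⟨?_, by simpa using hM₁⟩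
    rw [hgrad, smul_dotProduct, signedMinor_dotProduct_mulVec, smul_zero]
  · rw [← mulVec_zero M]
    exact (mulVec_injective_of_signedMinor_ne_zero M hi).ne (by simp)
  · obtain ⟨v, rfl⟩ := exists_mulVec_eq_of_signedMinor_dotProduct_eq_zero hMf (a := b)
      (by rw [hM, smul_dotProduct, hb, smul_zero])
    rw [mulVec, dotProduct, Fin.sum_univ_two]
    exact add_mem (Ideal.mul_mem_right _ _ (mem_irrelevantIdeal_pow (hM₁ i)))
      (Ideal.mul_mem_right _ _ (Ideal.pow_le_pow_right hd (mem_irrelevantIdeal_pow (hM₂ i))))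

end FreeCurves

section NearlyFreeCurves

/-- A presentation of a nearly free curve: up to the constant `c`, the partial derivatives of `f`
are the first three signed maximal minors of `M`, whose upper rows consist of forms of degree `e`
and whose last row is `(x, y, z)`. The fourth minor then spans the Jacobian module `N(f)`. -/
structure IsNearlyFreeMatrix (f : S) (e : ℕ) (c : ℂ) (M : Matrix (Fin 4) (Fin 3) S) : Prop where
  isHomogeneous (i l : Fin 3) : (M i.castSucc l).IsHomogeneous e
  last_row : M (Fin.last 3) = X
  ne_zero : c ≠ 0
  signedMinor_castSucc (i : Fin 3) : signedMinor M i.castSucc = c • grad f i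

namespace IsNearlyFreeMatrix

variable {f : S} {e : ℕ} {c : ℂ} {M : Matrix (Fin 4) (Fin 3) S}

lemma isHomogeneous_signedMinor_last (hM : IsNearlyFreeMatrix f e c M) :
    (signedMinor M (Fin.last 3)).IsHomogeneous (3 * e) := by
  have hdet : (M.submatrix Fin.castSucc id).det.IsHomogeneous (∑ _ : Fin 3, e) :=
    isHomogeneous_det fun i l => hM.isHomogeneous i l
  rw [Finset.sum_const, Finset.card_univ, Fintype.card_fin, smul_eq_mul] at hdet
  rw [signedMinor, Fin.succAbove_last, ← map_one C, ← map_neg, ← map_pow]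
  exact hdet.C_mul _

lemma signedMinor_dotProduct (hM : IsNearlyFreeMatrix f e c M) (a : Fin 4 → S) :
    signedMinor M ⬝ᵥ a =
      c • (grad f ⬝ᵥ Fin.init a) + signedMinor M (Fin.last 3) * a (Fin.last 3) := by
  rw [← smul_dotProduct, dotProduct, Fin.sum_univ_castSucc]
  simp only [hM.signedMinor_castSucc]
  rfl

lemma noCommonFactor_signedMinor (hM : IsNearlyFreeMatrix f e c M) (hf : NoCommonFactor (grad f)) :
    NoCommonFactor (signedMinor M) :=
  hf.of_eq_smul hM.ne_zero Fin.castSucc hM.signedMinor_castSucc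

lemma X_mul_signedMinor_last_mem (hM : IsNearlyFreeMatrix f e c M) (l : Fin 3) :
    X l * signedMinor M (Fin.last 3) ∈ jacobianIdeal f := by
  have hcol : signedMinor M ⬝ᵥ M.col l = 0 := congrFun (signedMinor_vecMul M) l
  rw [hM.signedMinor_dotProduct, col_apply, hM.last_row, ← dotProduct_smul, mul_comm] at hcol
  rw [eq_neg_of_add_eq_zero_right hcol]
  exact neg_mem (mem_span_range_iff_exists_dotProduct.2 ⟨_, rfl⟩)

lemma mul_signedMinor_last_mem (hM : IsNearlyFreeMatrix f e c M) {p : S}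
    (hp : p ∈ irrelevantIdeal) : p * signedMinor M (Fin.last 3) ∈ jacobianIdeal f := by
  have hle : irrelevantIdeal ≤ (jacobianIdeal f).colon {signedMinor M (Fin.last 3)} :=
    Ideal.span_le.2 <| Set.range_subset_iff.2 fun l =>
      Submodule.mem_colon_singleton.2 (hM.X_mul_signedMinor_last_mem l)
  exact Submodule.mem_colon_singleton.1 (hle hp)

lemma signedMinor_last_mem_saturation (hM : IsNearlyFreeMatrix f e c M) :
    signedMinor M (Fin.last 3) ∈ saturation (jacobianIdeal f) :=
  ⟨1, fun _ hp => hM.mul_signedMinor_last_mem (by rwa [pow_one] at hp)⟩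

lemma exists_sub_C_mul_signedMinor_last_mem (hM : IsNearlyFreeMatrix f e c M)
    (hf : NoCommonFactor (grad f)) {g : S} (hg : g ∈ saturation (jacobianIdeal f)) :
    ∃ r : ℂ, g - C r * signedMinor M (Fin.last 3) ∈ jacobianIdeal f := by
  have hle : jacobianIdeal f ≤ Ideal.span (Set.range (signedMinor M)) := by
    rw [jacobianIdeal, ← span_range_smul _ hM.ne_zero]
    exact Ideal.span_mono <| Set.range_subset_iff.2 fun i => ⟨_, hM.signedMinor_castSucc i⟩
  have hg' := saturation_mono hle hg
  rw [saturation_span_signedMinor (hM.noCommonFactor_signedMinor hf),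
    mem_span_range_iff_exists_dotProduct] at hg'
  obtain ⟨a, rfl⟩ := hg'
  set r := constantCoeff (a (Fin.last 3))
  have hr : a (Fin.last 3) - C r ∈ irrelevantIdeal := by simp [mem_irrelevantIdeal_iff, r]
  refine ⟨r, ?_⟩
  rw [hM.signedMinor_dotProduct, mul_comm, add_sub_assoc, ← sub_mul, ← dotProduct_smul]
  exact add_mem (mem_span_range_iff_exists_dotProduct.2 ⟨_, rfl⟩) (hM.mul_signedMinor_last_mem hr)

lemma signedMinor_last_notMem (hM : IsNearlyFreeMatrix f e c M) (hf : NoCommonFactor (grad f)) :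
    signedMinor M (Fin.last 3) ∉ jacobianIdeal f := by
  intro hmem
  obtain ⟨a, ha⟩ := mem_span_range_iff_exists_dotProduct.1 hmem
  obtain ⟨b, hb⟩ := exists_mulVec_eq_of_signedMinor_dotProduct_eq_zero
    (hM.noCommonFactor_signedMinor hf) (a := (Fin.snoc a (-C c) : Fin 4 → S)) (by
      rw [hM.signedMinor_dotProduct, Fin.init_snoc, Fin.snoc_last, ha, smul_eq_C_mul]; ring)
  have hlast : X ⬝ᵥ b = -C c := by
    rw [← hM.last_row, ← Fin.snoc_last (α := fun _ => S) (-C c) a, ← hb]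
    rfl
  have hconst := congrArg constantCoeff hlast
  simp [dotProduct, hM.ne_zero] at hconst

theorem nu_eq_one (hM : IsNearlyFreeMatrix f e c M) (hf : NoCommonFactor (grad f)) : nu f = 1 := by
  let π := Ideal.Quotient.mkₐ ℂ (jacobianIdeal f)
  set h := signedMinor M (Fin.last 3)
  have hπh : π h ≠ 0 := fun h0 =>
    hM.signedMinor_last_notMem hf (Ideal.Quotient.eq_zero_iff_mem.1 h0)
  have hle (j : ℕ) : jacobianModulePiece f j ≤ ℂ ∙ π h := by
    rintro _ ⟨g, ⟨hg, -⟩, rfl⟩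
    obtain ⟨r, hr⟩ := hM.exists_sub_C_mul_signedMinor_last_mem hf hg
    refine Submodule.mem_span_singleton.2 ⟨r, ?_⟩
    rw [← map_smul, smul_eq_C_mul]
    exact (Ideal.Quotient.eq.2 hr).symm
  refine le_antisymm (iSup_le fun j => ?_) (le_iSup_of_le (3 * e) ?_)
  · exact_mod_cast (Submodule.finrank_mono (hle j)).trans_eq (finrank_span_singleton hπh)
  · have heq : jacobianModulePiece f (3 * e) = ℂ ∙ π h :=
      (hle _).antisymm <| (Submodule.span_singleton_le_iff_mem _ _).2
        ⟨h, ⟨hM.signedMinor_last_mem_saturation, hM.isHomogeneous_signedMinor_last⟩, rfl⟩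
    rw [nDim, heq, finrank_span_singleton hπh, Nat.cast_one]

lemma jacobianRelation_init_mulVec (hM : IsNearlyFreeMatrix f e c M) {b : Fin 3 → S}
    (hb : X ⬝ᵥ b = 0) : grad f ⬝ᵥ Fin.init (α := fun _ => S) (M *ᵥ b) = 0 := by
  have horth := signedMinor_dotProduct_mulVec M b
  have hlast : (M *ᵥ b) (Fin.last 3) = 0 := by rw [mulVec, hM.last_row, hb]
  rw [hM.signedMinor_dotProduct, hlast, mul_zero, add_zero] at horth
  exact (smul_eq_zero_iff_right hM.ne_zero).1 horth

lemma exists_init_mulVec_eq (hM : IsNearlyFreeMatrix f e c M) (hf : NoCommonFactor (grad f))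
    {a : Fin 3 → S} (ha : grad f ⬝ᵥ a = 0) :
    ∃ b, X ⬝ᵥ b = 0 ∧ Fin.init (α := fun _ => S) (M *ᵥ b) = a := by
  obtain ⟨b, hb⟩ := exists_mulVec_eq_of_signedMinor_dotProduct_eq_zero
    (hM.noCommonFactor_signedMinor hf) (a := (Fin.snoc a 0 : Fin 4 → S)) (by
      rw [hM.signedMinor_dotProduct, Fin.init_snoc, Fin.snoc_last, ha, smul_zero, mul_zero,
        add_zero])
  refine ⟨b, ?_, by rw [hb, Fin.init_snoc]⟩
  rw [← hM.last_row, ← Fin.snoc_last (α := fun _ => S) 0 a, ← hb]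
  rfl

lemma mdr_eq_succ (hM : IsNearlyFreeMatrix f e c M) (hf : NoCommonFactor (grad f)) :
    mdr f = e + 1 := by
  obtain ⟨i, hi⟩ := (hM.noCommonFactor_signedMinor hf).exists_ne_zero
  have hkoszul : X ⬝ᵥ (![X 1, -X 0, 0] : Fin 3 → S) = 0 := by
    simp [dotProduct, Fin.sum_univ_three]; ring
  refine mdr_eq (a := Fin.init (α := fun _ => S) (M *ᵥ ![X 1, -X 0, 0])) ?_ ?_ fun a ha i => ?_
  · refine mem_jacobianRelationsPiece.2 ⟨hM.jacobianRelation_init_mulVec hkoszul, fun i => ?_⟩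
    refine IsHomogeneous.sum _ _ _ fun l _ => (hM.isHomogeneous i l).mul ?_
    fin_cases l
    exacts [isHomogeneous_X _ _, (isHomogeneous_X _ _).neg, isHomogeneous_zero _ _ _]
  · intro h0
    have hlast : (M *ᵥ ![X 1, -X 0, 0]) (Fin.last 3) = 0 := by rw [mulVec, hM.last_row, hkoszul]
    have hzero : M *ᵥ ![X 1, -X 0, 0] = M *ᵥ 0 := by
      rw [mulVec_zero, ← Fin.snoc_init_self (α := fun _ => S) (M *ᵥ _), h0, hlast]
      exact funext (Fin.lastCases (Fin.snoc_last _ _) (by simp))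
    have hvec := mulVec_injective_of_signedMinor_ne_zero M hi hzero
    exact X_ne_zero 1 (congrFun hvec 0)
  · obtain ⟨b, hb, rfl⟩ := hM.exists_init_mulVec_eq hf ha
    rw [pow_succ]
    change ∑ l, M i.castSucc l * b l ∈ _
    exact sum_mem fun l _ => Ideal.mul_mem_mul (mem_irrelevantIdeal_pow (hM.isHomogeneous i l))
      (mem_irrelevantIdeal_of_X_dotProduct_eq_zero hb l)

theorem isNearlyFreeWithExponents (hM : IsNearlyFreeMatrix f e c M) (hf : NoCommonFactor (grad f))
    {C : Set P2} (hC : IsReducedEquation C (2 * (e + 1)) f) :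
    IsNearlyFreeWithExponents C (e + 1) (e + 1) :=
  ⟨_, f, hC, hM.nu_eq_one hf, hM.mdr_eq_succ hf, (two_mul _).symm⟩

end IsNearlyFreeMatrix

end NearlyFreeCurves

section Homogeneity

lemma eval_smul_of_isHomogeneous {σ k : Type*} [CommSemiring k] {f : MvPolynomial σ k} {d : ℕ}
    (hf : f.IsHomogeneous d) (c : k) (v : σ → k) : eval (c • v) f = c ^ d * eval v f := by
  rw [eval_eq, eval_eq, Finset.mul_sum]
  refine Finset.sum_congr rfl fun m hm => ?_
  simp only [Pi.smul_apply, smul_eq_mul, mul_pow, Finset.prod_mul_distrib,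
    Finset.prod_pow_eq_pow_sum, hf.degree_eq_sum_deg_support hm]
  ring

lemma coeff_aeval_smul_X {σ k : Type*} [CommSemiring k] (c : k) (f : MvPolynomial σ k)
    (m : σ →₀ ℕ) :
    coeff m (aeval (fun i => c • (X i : MvPolynomial σ k)) f) = c ^ m.degree * coeff m f := by
  induction f using MvPolynomial.induction_on' with
  | monomial n a =>
    classical
    have h : aeval (fun i => c • (X i : MvPolynomial σ k)) (monomial n a) =
        c ^ n.degree • monomial n a := by
      simp only [aeval_monomial, smul_pow, Finsupp.prod, Finset.prod_smul,
        Finset.prod_pow_eq_pow_sum, algebraMap_eq, mul_smul_comm, Finsupp.degree_apply]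
      rw [monomial_eq, Finsupp.prod]
    rw [h, coeff_smul, smul_eq_mul, coeff_monomial]
    split_ifs with hnm
    · rw [hnm]
    · rw [mul_zero, mul_zero]
  | add p q hp hq => rw [map_add, coeff_add, coeff_add, hp, hq, mul_add]

lemma isHomogeneous_of_eval_smul {f : S} {d : ℕ}
    (h : ∀ (c : ℂ) (v : Fin 3 → ℂ), eval (c • v) f = c ^ d * eval v f) : f.IsHomogeneous d := by
  have hscale : aeval (fun i => (2 : ℂ) • (X i : S)) f = C (2 ^ d) * f := by
    refine MvPolynomial.funext fun v => ?_
    rw [eval_mul, eval_C, ← h, ← coe_aeval_eq_eval, RingHom.coe_coe, comp_aeval_apply]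
    simp [Pi.smul_def]
  intro m hm
  have hcoeff := coeff_aeval_smul_X 2 f m
  rw [hscale, coeff_C_mul] at hcoeff
  have hdeg : m.degree = d :=
    Nat.pow_right_injective le_rfl (by exact_mod_cast (mul_right_cancel₀ hm hcoeff).symm)
  rwa [Finsupp.degree_eq_weight_one] at hdeg

end Homogeneity

section LineRestriction

/-- The line `t ↦ P + t Q`, as a triple of polynomials in `t`. -/
noncomputable def line (P Q : Fin 3 → ℂ) (i : Fin 3) : Polynomial ℂ :=
  Polynomial.C (P i) + Polynomial.C (Q i) * Polynomial.X

variable (P Q : Fin 3 → ℂ)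

lemma natDegree_line_le (i : Fin 3) : (line P Q i).natDegree ≤ 1 := by
  unfold line
  compute_degree

lemma natDegree_aeval_line_le (f : S) : (aeval (line P Q) f).natDegree ≤ f.totalDegree := by
  simpa only [mul_one] using aeval_natDegree_le f le_rfl _ (natDegree_line_le P Q)

lemma eval_aeval_line (f : S) (t : ℂ) : (aeval (line P Q) f).eval t = eval (P + t • Q) f := by
  rw [← Polynomial.coe_aeval_eq_eval, comp_aeval_apply, ← coe_aeval_eq_eval, RingHom.coe_coe]
  congr 2
  ext i
  simp [line, mul_comm t]

variable {P Q}

lemma coeff_aeval_line {f : S} {d : ℕ} (hf : f.IsHomogeneous d) :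
    (aeval (line P Q) f).coeff d = eval Q f := by
  rw [aeval_def, eval₂_eq', eval_eq', Polynomial.finsetSum_coeff]
  refine Finset.sum_congr rfl fun m hm => ?_
  have hpow (i : Fin 3) : (line P Q i ^ m i).natDegree ≤ m i * 1 :=
    Polynomial.natDegree_pow_le_of_le _ (natDegree_line_le P Q i)
  have hcoeff (i : Fin 3) : (line P Q i ^ m i).coeff (m i * 1) = Q i ^ m i := by
    rw [Polynomial.coeff_pow_of_natDegree_le (natDegree_line_le P Q i)]
    simp [line]
  have hd : d = m 0 * 1 + m 1 * 1 + m 2 * 1 := by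
    rw [hf.degree_eq_sum_deg_support hm, Finset.sum_subset (Finset.subset_univ _) (by simp),
      Fin.sum_univ_three]
    ring
  rw [Polynomial.algebraMap_eq, Polynomial.coeff_C_mul, Fin.prod_univ_three, Fin.prod_univ_three,
    hd, Polynomial.coeff_mul_add_eq_of_natDegree_le
      (Polynomial.natDegree_mul_le_of_le (hpow 0) (hpow 1)) (hpow 2),
    Polynomial.coeff_mul_add_eq_of_natDegree_le (hpow 0) (hpow 1), hcoeff, hcoeff, hcoeff]

/-- A common factor of the forms `D i` is a form; if it had positive degree, it would vanish
somewhere on the line through `P` and `Q`. -/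
lemma noCommonFactor_of_line {ι : Type*} {D : ι → S} {d : ℕ} (hD : ∀ i, (D i).IsHomogeneous d)
    (hQ : ∃ i, eval Q (D i) ≠ 0) (hPQ : ∀ t : ℂ, ∃ i, eval (P + t • Q) (D i) ≠ 0) :
    NoCommonFactor D := by
  intro g hg
  have hline : (aeval (line P Q) g).natDegree = 0 := by
    by_contra hne
    obtain ⟨t, ht⟩ := IsAlgClosed.exists_root (aeval (line P Q) g) fun h0 =>
      hne (Polynomial.natDegree_eq_of_degree_eq_some h0)
    rw [Polynomial.IsRoot, eval_aeval_line] at ht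
    obtain ⟨i, hi⟩ := hPQ t
    exact hi (eq_zero_of_zero_dvd (ht ▸ map_dvd (eval _) (hg i)))
  obtain ⟨i, hi⟩ := hQ
  obtain ⟨h, hgh⟩ := hg i
  have hDi : D i ≠ 0 := fun h0 => hi (by rw [h0, map_zero])
  have hg0 : g ≠ 0 := left_ne_zero_of_mul (hgh ▸ hDi)
  have hh0 : h ≠ 0 := right_ne_zero_of_mul (hgh ▸ hDi)
  have hdeg : g.totalDegree + h.totalDegree = d := by
    rw [← totalDegree_mul_of_isDomain hg0 hh0, ← hgh, (hD i).totalDegree hDi]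
  have hle : d ≤ h.totalDegree := by
    rw [← coeff_aeval_line (P := P) (hD i)] at hi
    calc d ≤ (aeval (line P Q) g * aeval (line P Q) h).natDegree := by
          rw [← map_mul, ← hgh]
          exact Polynomial.le_natDegree_of_ne_zero hi
      _ ≤ (aeval (line P Q) g).natDegree + (aeval (line P Q) h).natDegree :=
          Polynomial.natDegree_mul_le
      _ ≤ h.totalDegree := by
          rw [hline, zero_add]
          exact natDegree_aeval_line_le P Q h
  obtain ⟨a, rfl⟩ : ∃ a, g = C a := ⟨_, totalDegree_eq_zero_iff_eq_C.1 (by omega)⟩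
  exact (isUnit_iff_ne_zero.2 fun ha => hg0 (by rw [ha, C_0])).map C

end LineRestriction

section ZeroSets

lemma mk_mem_zeroSet_iff {f : S} {d : ℕ} (hf : f.IsHomogeneous d) {v : Fin 3 → ℂ} (hv : v ≠ 0) :
    Projectivization.mk ℂ v hv ∈ zeroSet f ↔ eval v f = 0 := by
  obtain ⟨a, ha⟩ := Projectivization.exists_smul_eq_mk_rep ℂ v hv
  rw [zeroSet, Set.mem_ofPred_eq, ← ha, Units.smul_def, eval_smul_of_isHomogeneous hf]
  simp

lemma image_map_zeroSet {f g : S} {d : ℕ} (hf : f.IsHomogeneous d) (hg : g.IsHomogeneous d)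
    (e : (Fin 3 → ℂ) ≃ₗ[ℂ] (Fin 3 → ℂ)) (h : ∀ v, eval (e v) g = eval v f) :
    Projectivization.map e.toLinearMap e.injective '' zeroSet f = zeroSet g := by
  ext p
  constructor
  · rintro ⟨q, hq, rfl⟩
    induction q using Projectivization.ind with | _ v hv
    rw [mk_mem_zeroSet_iff hf] at hq
    rw [Projectivization.map_mk, mk_mem_zeroSet_iff hg]
    exact (h v).trans hq
  · induction p using Projectivization.ind with | _ w hw
    intro hp
    have hv : e.symm w ≠ 0 := e.symm.map_ne_zero_iff.2 hw
    refine ⟨Projectivization.mk ℂ _ hv, ?_, ?_⟩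
    · rwa [mk_mem_zeroSet_iff hf, ← h, e.apply_symm_apply, ← mk_mem_zeroSet_iff hg hw]
    · simp [Projectivization.map_mk]

lemma exists_smul_eq_chart {v : Fin 3 → ℂ} (hv : v ≠ 0) :
    ∃ c : ℂ, c ≠ 0 ∧
      ((∃ y z, v = c • ![1, y, z]) ∨ (∃ z, v = c • ![0, 1, z]) ∨ v = c • ![0, 0, 1]) := by
  have hv₃ : v = ![v 0, v 1, v 2] := List.ofFn_inj.1 rfl
  by_cases hx : v 0 = 0
  · by_cases hy : v 1 = 0
    · have hz : v 2 ≠ 0 := fun hz => hv (by rw [hv₃, hx, hy, hz]; simp)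
      exact ⟨v 2, hz, .inr (.inr (by rw [hv₃, hx, hy]; simp))⟩
    · exact ⟨v 1, hy, .inr (.inl ⟨v 2 / v 1, by rw [hv₃, hx]; simp [mul_div_cancel₀ _ hy]⟩)⟩
  · refine ⟨v 0, hx, .inl ⟨v 1 / v 0, v 2 / v 0, ?_⟩⟩
    rw [hv₃]
    simp [mul_div_cancel₀ _ hx]

lemma zeroSet_eq_parametrized {f : S} {d : ℕ} (hf : f.IsHomogeneous d)
    {φ : ℂ → ℂ → Fin 3 → ℂ} (hφ : ∀ s t, eval (φ s t) f = 0)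
    (h₁ : ∀ y z, eval ![1, y, z] f = 0 → ∃ s t c : ℂ, c ≠ 0 ∧ φ s t = c • ![1, y, z])
    (h₂ : ∀ z, eval ![0, 1, z] f = 0 → ∃ s t c : ℂ, c ≠ 0 ∧ φ s t = c • ![0, 1, z])
    (h₃ : φ 0 1 = ![0, 0, 1]) :
    zeroSet f = parametrized φ := by
  ext p
  induction p using Projectivization.ind with | _ v hv
  rw [mk_mem_zeroSet_iff hf]
  constructor
  · intro hfv
    suffices h : ∃ s t c : ℂ, c ≠ 0 ∧ φ s t = c • v by
      obtain ⟨s, t, c, hc, hst⟩ := h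
      have h0 : φ s t ≠ 0 := hst ▸ smul_ne_zero hc hv
      exact ⟨s, t, h0, ((Projectivization.mk_eq_mk_iff' ℂ _ _ h0 hv).2 ⟨c, hst.symm⟩).symm⟩
    obtain ⟨a, ha, hchart⟩ := exists_smul_eq_chart hv
    have hrep {w : Fin 3 → ℂ} (hw : v = a • w)
        (hφw : eval w f = 0 → ∃ s t c : ℂ, c ≠ 0 ∧ φ s t = c • w) :
        ∃ s t c : ℂ, c ≠ 0 ∧ φ s t = c • v := by
      rw [hw, eval_smul_of_isHomogeneous hf] at hfv
      obtain ⟨s, t, c, hc, hst⟩ := hφw ((mul_eq_zero_iff_left (pow_ne_zero d ha)).1 hfv)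
      exact ⟨s, t, c * a⁻¹, mul_ne_zero hc (inv_ne_zero ha), by
        rw [hst, hw, smul_smul, inv_mul_cancel_right₀ ha]⟩
    obtain ⟨y, z, hw⟩ | ⟨z, hw⟩ | hw := hchart
    · exact hrep hw (h₁ y z)
    · exact hrep hw (h₂ z)
    · exact hrep hw fun _ => ⟨0, 1, 1, one_ne_zero, by rw [h₃, one_smul]⟩
  · rintro ⟨s, t, h0, hst⟩
    rw [← mk_mem_zeroSet_iff hf hv, hst, mk_mem_zeroSet_iff hf]
    exact hφ s t

end ZeroSets

section Roots

lemma exists_add_eq_mul_eq (p q : ℂ) : ∃ a b, a + b = p ∧ a * b = q := by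
  obtain ⟨r, hr⟩ := IsAlgClosed.exists_pow_nat_eq (p ^ 2 - 4 * q) two_pos
  exact ⟨(p + r) / 2, (p - r) / 2, by ring, by linear_combination -hr / 4⟩

lemma exists_roots_depressed_cubic (p q : ℂ) :
    ∃ a b c, a + b + c = 0 ∧ a * b + b * c + c * a = p ∧ a * b * c = q := by
  obtain ⟨a, ha⟩ : ∃ a : ℂ, a ^ 3 + p * a - q = 0 := by
    have hdeg : (.X ^ 3 + .C p * .X - .C q : Polynomial ℂ).degree = 3 := by compute_degree!
    obtain ⟨a, ha⟩ := IsAlgClosed.exists_root _ (hdeg.trans_ne three_ne_zero)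
    exact ⟨a, by simpa [Polynomial.IsRoot] using ha⟩
  obtain ⟨b, c, hadd, hmul⟩ := exists_add_eq_mul_eq (-a) (p + a ^ 2)
  exact ⟨a, b, c, by linear_combination hadd, by linear_combination a * hadd + hmul,
    by linear_combination a * hmul + ha⟩

lemma exists_root_quadratic {A p q w : ℂ} (h : w ^ 2 - A * p * w + A ^ 2 * q = 0) :
    ∃ t, t ^ 2 - p * t + q = 0 ∧ w = A * t := by
  obtain ⟨a, b, rfl, rfl⟩ := exists_add_eq_mul_eq p q
  have hnorm : (w - A * a) * (w - A * b) = 0 := by linear_combination h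
  obtain hw | hw := mul_eq_zero.1 hnorm
  exacts [⟨a, by ring, sub_eq_zero.1 hw⟩, ⟨b, by ring, sub_eq_zero.1 hw⟩]

/-- The cubic in `w` is the norm of `w - (A * t ^ 2 + B * t)`, taken over the roots `t`. -/
lemma exists_root_cubic {A B p q w : ℂ}
    (h : w ^ 3 + 2 * p * A * w ^ 2 + (B ^ 2 * p - 3 * A * B * q + A ^ 2 * p ^ 2) * w
      - q * (B ^ 3 + A ^ 2 * B * p + A ^ 3 * q) = 0) :
    ∃ t, t ^ 3 + p * t - q = 0 ∧ w = A * t ^ 2 + B * t := by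
  obtain ⟨a, b, c, habc, rfl, rfl⟩ := exists_roots_depressed_cubic p q
  obtain rfl : c = -a - b := by linear_combination habc
  have hnorm : (w - (A * a ^ 2 + B * a)) * (w - (A * b ^ 2 + B * b)) *
      (w - (A * (-a - b) ^ 2 + B * (-a - b))) = 0 := by linear_combination h
  obtain (hw | hw) | hw := (mul_eq_zero.1 hnorm).imp_left mul_eq_zero.1
  exacts [⟨a, by ring, sub_eq_zero.1 hw⟩, ⟨b, by ring, sub_eq_zero.1 hw⟩,
    ⟨-a - b, by ring, sub_eq_zero.1 hw⟩]

end Roots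

section Gradients

lemma pderiv_ofNat (i : Fin 3) (n : ℕ) [n.AtLeastTwo] : pderiv i (ofNat(n) : S) = 0 := by
  rw [← map_ofNat (C : ℂ →+* S), pderiv_C]

lemma noCommonFactor_grad_of_line {f : S} {d : ℕ} (hf : f.IsHomogeneous d) {P Q : Fin 3 → ℂ}
    (hQ : ∃ i, eval Q (grad f i) ≠ 0) (v : ℂ → Fin 3 → ℂ) {c : ℂ} (hc : c ≠ 0)
    (hv : ∀ t, ∑ i, v t i * eval (P + t • Q) (grad f i) = c) : NoCommonFactor (grad f) := by
  refine noCommonFactor_of_line (P := P) (fun _ => hf.pderiv) hQ fun t => ?_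
  by_contra! h
  exact hc (by simp [← hv t, h])

end Gradients

section Quintic

lemma isHomogeneous_quinticEq : quinticEq.IsHomogeneous 5 :=
  isHomogeneous_of_eval_smul fun c v => by simp [quinticEq]; ring

lemma grad_quinticEq : grad quinticEq =
    ![48 * X 0 ^ 2 * X 2 ^ 2 - 48 * X 0 * X 1 ^ 2 * X 2 + 9 * X 1 ^ 4 + 48 * X 1 ^ 3 * X 2,
      -48 * X 0 ^ 2 * X 1 * X 2 + 36 * X 0 * X 1 ^ 3 + 144 * X 0 * X 1 ^ 2 * X 2 - 20 * X 1 ^ 4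
        - 64 * X 1 ^ 3 * X 2,
      32 * X 0 ^ 3 * X 2 - 24 * X 0 ^ 2 * X 1 ^ 2 + 48 * X 0 * X 1 ^ 3 - 16 * X 1 ^ 4] := by
  ext1 i
  fin_cases i <;>
    simp [grad, quinticEq, pderiv_X, pderiv_ofNat, Derivation.leibniz_pow] <;> ring

lemma noCommonFactor_grad_quinticEq : NoCommonFactor (grad quinticEq) :=
  noCommonFactor_grad_of_line isHomogeneous_quinticEq (P := ![-1, -1, 0]) (Q := ![-1, 0, 1])
    ⟨0, by simp [grad_quinticEq]⟩ (fun t => ![64 + 44 * t, 9, 30 + 66 * t]) (c := 960)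
    (by norm_num) fun t => by simp [grad_quinticEq, Fin.sum_univ_three]; ring

lemma zeroSet_quinticEq : zeroSet quinticEq = quintic := by
  refine zeroSet_eq_parametrized isHomogeneous_quinticEq (fun s t => ?_) (fun y z h => ?_)
    (fun z h => ?_) (by simp)
  · simp [quinticEq]
    ring
  · obtain ⟨t, ht, hz⟩ := exists_root_quadratic (A := y ^ 3 - 2 * y ^ 2) (p := y) (q := y / 2)
      (w := z + y ^ 3 / 2 - 3 / 4 * y ^ 2)
      (by linear_combination (norm := (simp [quinticEq]; ring)) h / 16)
    refine ⟨1, t, t - 1 / 2, fun h0 => ?_, ?_⟩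
    · rw [sub_eq_zero.1 h0] at ht
      ring_nf at ht
      norm_num at ht
    · ext i
      fin_cases i <;> simp
      · linear_combination ht
      · linear_combination (t ^ 3 + t ^ 2 * y - 3 / 2 * t ^ 2 + t * y ^ 2 - 2 * t * y
          - 1 / 2 * y ^ 2 + 3 / 4 * y) * ht - (t - 1 / 2) * hz
  · obtain rfl : z = -1 / 4 := by
      linear_combination (norm := (simp [quinticEq]; ring)) -h / 16
    refine ⟨1, 1 / 2, 1 / 4, by norm_num, ?_⟩
    ext i
    fin_cases i <;> norm_num

lemma isReducedEquation_quintic : IsReducedEquation quintic 5 quinticEq :=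
  ⟨isHomogeneous_quinticEq, squarefree_of_noCommonFactor_grad noCommonFactor_grad_quinticEq,
    zeroSet_quinticEq⟩

/-- Two generating Jacobian relations of `𝒞₅`, as columns. -/
noncomputable def quinticRelations : Matrix (Fin 3) (Fin 2) S :=
  !![-180 * X 0 * X 1 - 128 * X 0 * X 2 + 100 * X 1 ^ 2, 40 * X 0 ^ 2 - 32 * X 0 * X 1;
    -60 * X 0 * X 2 + 45 * X 1 ^ 2 - 48 * X 1 * X 2, -12 * X 1 ^ 2;
    180 * X 1 * X 2 + 192 * X 2 ^ 2, -60 * X 0 * X 2 + 15 * X 1 ^ 2 + 48 * X 1 * X 2]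

lemma signedMinor_quinticRelations : signedMinor quinticRelations = (75 : ℂ) • grad quinticEq := by
  ext1 i
  fin_cases i <;>
    simp [signedMinor, quinticRelations, grad_quinticEq, det_fin_two, Fin.succAbove,
      ofNat_smul_eq_nsmul] <;> ring

theorem isFreeWithExponents_quintic : IsFreeWithExponents quintic 2 2 := by
  refine isFreeWithExponents_of_signedMinor_eq_smul_grad isReducedEquation_quintic
    noCommonFactor_grad_quinticEq le_rfl (fun i => ?_) (fun i => ?_) (by norm_num)
    signedMinor_quinticRelations <;>
  · refine isHomogeneous_of_eval_smul fun c v => ?_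
    fin_cases i <;> simp [quinticRelations] <;> ring

end Quintic

section QuinticThreeA4

/-- A reduced equation of `𝒞₅'`, found by eliminating `s` and `t`. -/
noncomputable def quinticEq' : S :=
  -709375 * X 0 ^ 5 - 4800000 * X 0 ^ 4 * X 1 + 3360000 * X 0 ^ 4 * X 2
    - 54560000 * X 0 ^ 3 * X 1 ^ 2 + 17664000 * X 0 ^ 3 * X 1 * X 2
    - 4915200 * X 0 ^ 3 * X 2 ^ 2 + 199424000 * X 0 ^ 2 * X 1 ^ 3
    - 18022400 * X 0 ^ 2 * X 1 ^ 2 * X 2 + 3932160 * X 0 ^ 2 * X 1 * X 2 ^ 2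
    + 1048576 * X 0 ^ 2 * X 2 ^ 3 - 265420800 * X 0 * X 1 ^ 4
    - 49807360 * X 0 * X 1 ^ 3 * X 2 - 2097152 * X 0 * X 1 ^ 2 * X 2 ^ 2
    + 8126464 * X 1 ^ 5 + 1048576 * X 1 ^ 4 * X 2

lemma isHomogeneous_quinticEq' : quinticEq'.IsHomogeneous 5 :=
  isHomogeneous_of_eval_smul fun c v => by simp [quinticEq']; ring

lemma grad_quinticEq' : grad quinticEq' =
    ![-3546875 * X 0 ^ 4 - 19200000 * X 0 ^ 3 * X 1 + 13440000 * X 0 ^ 3 * X 2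
        - 163680000 * X 0 ^ 2 * X 1 ^ 2 + 52992000 * X 0 ^ 2 * X 1 * X 2
        - 14745600 * X 0 ^ 2 * X 2 ^ 2 + 398848000 * X 0 * X 1 ^ 3
        - 36044800 * X 0 * X 1 ^ 2 * X 2 + 7864320 * X 0 * X 1 * X 2 ^ 2
        + 2097152 * X 0 * X 2 ^ 3 - 265420800 * X 1 ^ 4 - 49807360 * X 1 ^ 3 * X 2
        - 2097152 * X 1 ^ 2 * X 2 ^ 2,
      -4800000 * X 0 ^ 4 - 109120000 * X 0 ^ 3 * X 1 + 17664000 * X 0 ^ 3 * X 2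
        + 598272000 * X 0 ^ 2 * X 1 ^ 2 - 36044800 * X 0 ^ 2 * X 1 * X 2
        + 3932160 * X 0 ^ 2 * X 2 ^ 2 - 1061683200 * X 0 * X 1 ^ 3
        - 149422080 * X 0 * X 1 ^ 2 * X 2 - 4194304 * X 0 * X 1 * X 2 ^ 2
        + 40632320 * X 1 ^ 4 + 4194304 * X 1 ^ 3 * X 2,
      3360000 * X 0 ^ 4 + 17664000 * X 0 ^ 3 * X 1 - 9830400 * X 0 ^ 3 * X 2
        - 18022400 * X 0 ^ 2 * X 1 ^ 2 + 7864320 * X 0 ^ 2 * X 1 * X 2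
        + 3145728 * X 0 ^ 2 * X 2 ^ 2 - 49807360 * X 0 * X 1 ^ 3
        - 4194304 * X 0 * X 1 ^ 2 * X 2 + 1048576 * X 1 ^ 4] := by
  ext1 i
  fin_cases i <;>
    simp [grad, quinticEq', pderiv_X, pderiv_ofNat, Derivation.leibniz_pow] <;> ring

lemma noCommonFactor_grad_quinticEq' : NoCommonFactor (grad quinticEq') :=
  noCommonFactor_grad_of_line isHomogeneous_quinticEq' (P := ![-1, 0, 0]) (Q := ![0, 1, 0])
    ⟨2, by simp [grad_quinticEq']⟩ (fun t =>
      ![-133265739776 * t - 2179408431840, -1205315217472 * t + 30145461740,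
        12973074296240 * t + 639297469075]) (c := 9733430561422500000)
    (by norm_num) fun t => by simp [grad_quinticEq', Fin.sum_univ_three]; ring

lemma zeroSet_quinticEq' : zeroSet quinticEq' = quintic' := by
  refine zeroSet_eq_parametrized isHomogeneous_quinticEq' (fun s t => ?_) (fun y z h => ?_)
    (fun z h => ?_) (by simp)
  · simp [quinticEq']
    ring
  · obtain ⟨t, ht, hz⟩ := exists_root_cubic (A := y + 15 / 4) (B := -5 * y + 75 / 32) (p := -y)
      (q := 5 / 32 - y) (w := z + 15 / 4 * y - 25 / 16)
      (by linear_combination (norm := (simp [quinticEq']; ring)) h / 1048576)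
    refine ⟨1, t, t - 1, fun h0 => ?_, ?_⟩
    · rw [sub_eq_zero.1 h0] at ht
      ring_nf at ht
      norm_num at ht
    · ext i
      fin_cases i <;> simp
      · linear_combination ht
      · linear_combination (t ^ 2 - 5 * t - 15 / 4) * ht - (t - 1) * hz
  · obtain rfl : z = -31 / 4 := by
      linear_combination (norm := (simp [quinticEq']; ring)) h / 1048576
    refine ⟨1, 1, 27 / 32, by norm_num, ?_⟩
    ext i
    fin_cases i <;> norm_num

lemma isReducedEquation_quintic' : IsReducedEquation quintic' 5 quinticEq' :=
  ⟨isHomogeneous_quinticEq', squarefree_of_noCommonFactor_grad noCommonFactor_grad_quinticEq',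
    zeroSet_quinticEq'⟩

/-- Two generating Jacobian relations of `𝒞₅'`, as columns. -/
noncomputable def quinticRelations' : Matrix (Fin 3) (Fin 2) S :=
  !![3840 * X 0 ^ 2 - 2048 * X 0 * X 1,
      -33280 * X 0 * X 1 - 6144 * X 0 * X 2 + 2048 * X 1 ^ 2;
    400 * X 0 ^ 2 - 2560 * X 0 * X 1 + 512 * X 0 * X 2 - 512 * X 1 ^ 2,
      875 * X 0 ^ 2 + 1600 * X 0 * X 1 - 3200 * X 0 * X 2 + 18560 * X 1 ^ 2;
    4625 * X 0 ^ 2 + 4800 * X 0 * X 1 - 3200 * X 0 * X 2 + 19840 * X 1 ^ 2 + 2048 * X 1 * X 2,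
      1250 * X 0 ^ 2 - 11000 * X 0 * X 1 - 12000 * X 0 * X 2 - 200800 * X 1 ^ 2
        + 23040 * X 1 * X 2 + 4096 * X 2 ^ 2]

lemma signedMinor_quinticRelations' :
    signedMinor quinticRelations' = grad quinticEq' := by
  ext1 i
  fin_cases i <;>
    simp [signedMinor, quinticRelations', grad_quinticEq', det_fin_two, Fin.succAbove] <;> ring

theorem isFreeWithExponents_quintic' : IsFreeWithExponents quintic' 2 2 := by
  refine isFreeWithExponents_of_signedMinor_eq_smul_grad isReducedEquation_quintic'
    noCommonFactor_grad_quinticEq' le_rfl (fun i => ?_) (fun i => ?_) one_ne_zero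
    (signedMinor_quinticRelations'.trans (one_smul ℂ _).symm) <;>
  · refine isHomogeneous_of_eval_smul fun c v => ?_
    fin_cases i <;> simp [quinticRelations'] <;> ring

end QuinticThreeA4

section QuinticA6

lemma isHomogeneous_quinticEq'' : quinticEq''.IsHomogeneous 5 :=
  isHomogeneous_of_eval_smul fun c v => by simp [quinticEq'']; ring

lemma grad_quinticEq'' : grad quinticEq'' =
    ![-135 * X 0 ^ 4 - 54 * X 0 ^ 2 * X 1 * X 2 + 4 * X 0 * X 1 ^ 3 + 2 * X 0 * X 2 ^ 3
        - 2 * X 1 ^ 2 * X 2 ^ 2,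
      -18 * X 0 ^ 3 * X 2 + 6 * X 0 ^ 2 * X 1 ^ 2 - 4 * X 0 * X 1 * X 2 ^ 2 + 4 * X 1 ^ 3 * X 2,
      -18 * X 0 ^ 3 * X 1 + 3 * X 0 ^ 2 * X 2 ^ 2 - 4 * X 0 * X 1 ^ 2 * X 2 + X 1 ^ 4] := by
  ext1 i
  fin_cases i <;>
    simp [grad, quinticEq'', pderiv_X, pderiv_ofNat, Derivation.leibniz_pow] <;> ring

lemma noCommonFactor_grad_quinticEq'' : NoCommonFactor (grad quinticEq'') :=
  noCommonFactor_grad_of_line isHomogeneous_quinticEq'' (P := ![0, 1, 0]) (Q := ![1, 0, 0])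
    ⟨0, by simp [grad_quinticEq'']⟩ (fun t => ![0, 3 * t, 1]) (c := 1)
    one_ne_zero fun t => by simp [grad_quinticEq'', Fin.sum_univ_three]; ring

lemma zeroSet_quinticEq'' : zeroSet quinticEq'' = quintic'' := by
  refine zeroSet_eq_parametrized isHomogeneous_quinticEq'' (fun s t => ?_) (fun y z h => ?_)
    (fun z h => ?_) (by simp)
  · simp [quinticEq'']
    ring
  · obtain ⟨t, ht, rfl⟩ := exists_root_cubic (A := y) (B := 3) (p := -y) (q := 1) (w := z)
      (by linear_combination (norm := (simp [quinticEq'']; ring)) h)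
    refine ⟨1, t, t, fun h0 => by simp [h0] at ht, ?_⟩
    ext i
    fin_cases i <;> simp
    · linear_combination ht
    · linear_combination t ^ 2 * ht
  · obtain rfl : z = 0 := by simpa [quinticEq''] using h
    exact ⟨1, 0, -1, by norm_num, by simp⟩

lemma isReducedEquation_quintic'' : IsReducedEquation quintic'' 5 quinticEq'' :=
  ⟨isHomogeneous_quinticEq'', squarefree_of_noCommonFactor_grad noCommonFactor_grad_quinticEq'',
    zeroSet_quinticEq''⟩

/-- Two generating Jacobian relations of `𝒞₅''`, as columns. -/
noncomputable def quinticRelations'' : Matrix (Fin 3) (Fin 2) S :=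
  !![-12 * X 0 * X 1, -42 * X 0 * X 2 + 30 * X 1 ^ 2;
    15 * X 0 * X 2 - 7 * X 1 ^ 2, 315 * X 0 ^ 2 + 8 * X 1 * X 2;
    90 * X 0 ^ 2 + 28 * X 1 * X 2, -120 * X 0 * X 1 + 28 * X 2 ^ 2]

lemma signedMinor_quinticRelations'' :
    signedMinor quinticRelations'' = (210 : ℂ) • grad quinticEq'' := by
  ext1 i
  fin_cases i <;>
    simp [signedMinor, quinticRelations'', grad_quinticEq'', det_fin_two, Fin.succAbove,
      ofNat_smul_eq_nsmul] <;> ring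

theorem isFreeWithExponents_quintic'' : IsFreeWithExponents quintic'' 2 2 := by
  refine isFreeWithExponents_of_signedMinor_eq_smul_grad isReducedEquation_quintic''
    noCommonFactor_grad_quinticEq'' le_rfl (fun i => ?_) (fun i => ?_) (by norm_num)
    signedMinor_quinticRelations'' <;>
  · refine isHomogeneous_of_eval_smul fun c v => ?_
    fin_cases i <;> simp [quinticRelations''] <;> ring

end QuinticA6

section QuarticEq

lemma isHomogeneous_quarticEq : quarticEq.IsHomogeneous 4 :=
  isHomogeneous_of_eval_smul fun c v => by simp [quarticEq]; ring

lemma grad_quarticEq : grad quarticEq =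
    ![2 * X 0 * X 1 ^ 2 - 4 * X 0 * X 1 * X 2 + 2 * X 0 * X 2 ^ 2 - 2 * X 1 ^ 2 * X 2
        - 2 * X 1 * X 2 ^ 2,
      2 * X 0 ^ 2 * X 1 - 2 * X 0 ^ 2 * X 2 - 4 * X 0 * X 1 * X 2 - 2 * X 0 * X 2 ^ 2
        + 2 * X 1 * X 2 ^ 2,
      -2 * X 0 ^ 2 * X 1 + 2 * X 0 ^ 2 * X 2 - 2 * X 0 * X 1 ^ 2 - 4 * X 0 * X 1 * X 2
        + 2 * X 1 ^ 2 * X 2] := by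
  ext1 i
  fin_cases i <;>
    simp [grad, quarticEq, pderiv_X, pderiv_ofNat, Derivation.leibniz_pow] <;> ring

lemma noCommonFactor_grad_quarticEq : NoCommonFactor (grad quarticEq) :=
  noCommonFactor_grad_of_line isHomogeneous_quarticEq (P := ![-2, -1, 0]) (Q := ![-1, 0, 1])
    ⟨0, by simp [grad_quarticEq]⟩ (fun _ => ![1, 0, 1]) (c := 8)
    (by norm_num) fun t => by simp [grad_quarticEq, Fin.sum_univ_three]; ring

lemma isReducedEquation_quarticEq : IsReducedEquation (zeroSet quarticEq) 4 quarticEq :=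
  ⟨isHomogeneous_quarticEq, squarefree_of_noCommonFactor_grad noCommonFactor_grad_quarticEq, rfl⟩

/-- The linear syzygies, as columns, of the partial derivatives of `quarticEq` and one further
cubic. -/
noncomputable def quarticSyzygies : Matrix (Fin 4) (Fin 3) S :=
  !![-X 0, 3 * X 0 - 2 * X 1, -3 * X 0;
    2 * X 0 - 3 * X 1, X 1, 3 * X 1;
    -X 0 + 3 * X 2, X 1 - 3 * X 2, 0;
    X 0, X 1, X 2]

lemma isNearlyFreeMatrix_quarticSyzygies :
    IsNearlyFreeMatrix quarticEq 1 (-3) quarticSyzygies where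
  isHomogeneous i l := by
    refine isHomogeneous_of_eval_smul fun c v => ?_
    fin_cases i <;> fin_cases l <;> simp [quarticSyzygies] <;> ring
  last_row := by
    ext1 l
    fin_cases l <;> rfl
  ne_zero := by norm_num
  signedMinor_castSucc i := by
    fin_cases i <;>
      simp [signedMinor, quarticSyzygies, grad_quarticEq, det_fin_three, Fin.succAbove,
        ofNat_smul_eq_nsmul] <;> ring

theorem isNearlyFreeWithExponents_quarticEq :
    IsNearlyFreeWithExponents (zeroSet quarticEq) 2 2 :=
  isNearlyFreeMatrix_quarticSyzygies.isNearlyFreeWithExponents noCommonFactor_grad_quarticEq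
    isReducedEquation_quarticEq

end QuarticEq

section TricuspidalQuartic

/-- The equation of the tricuspidal quartic in the coordinates of its parametrization. -/
noncomputable def tricuspidalEq : S :=
  4 * X 0 ^ 2 * X 2 ^ 2 + 8 * X 0 * X 1 ^ 3 + 12 * X 0 * X 1 ^ 2 * X 2 - 3 * X 1 ^ 4
    - 4 * X 1 ^ 3 * X 2

lemma isHomogeneous_tricuspidalEq : tricuspidalEq.IsHomogeneous 4 :=
  isHomogeneous_of_eval_smul fun c v => by simp [tricuspidalEq]; ring

lemma grad_tricuspidalEq : grad tricuspidalEq =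
    ![8 * X 0 * X 2 ^ 2 + 8 * X 1 ^ 3 + 12 * X 1 ^ 2 * X 2,
      24 * X 0 * X 1 ^ 2 + 24 * X 0 * X 1 * X 2 - 12 * X 1 ^ 3 - 12 * X 1 ^ 2 * X 2,
      8 * X 0 ^ 2 * X 2 + 12 * X 0 * X 1 ^ 2 - 4 * X 1 ^ 3] := by
  ext1 i
  fin_cases i <;>
    simp [grad, tricuspidalEq, pderiv_X, pderiv_ofNat, Derivation.leibniz_pow] <;> ring

lemma noCommonFactor_grad_tricuspidalEq : NoCommonFactor (grad tricuspidalEq) :=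
  noCommonFactor_grad_of_line isHomogeneous_tricuspidalEq (P := ![0, 1, 0]) (Q := ![-1, 0, 1])
    ⟨0, by simp [grad_tricuspidalEq]⟩ (fun _ => ![1, 0, 1]) (c := 4)
    (by norm_num) fun t => by simp [grad_tricuspidalEq, Fin.sum_univ_three]; ring

lemma zeroSet_tricuspidalEq : zeroSet tricuspidalEq = quartic := by
  refine zeroSet_eq_parametrized isHomogeneous_tricuspidalEq (fun s t => ?_) (fun y z h => ?_)
    (fun z h => ?_) (by simp)
  · simp [tricuspidalEq]
    ring
  · obtain ⟨t, ht, hz⟩ := exists_root_quadratic (A := y ^ 2 - 2 * y) (p := y) (q := y / 2)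
      (w := z + y ^ 2 / 2)
      (by linear_combination (norm := (simp [tricuspidalEq]; ring)) h / 4)
    refine ⟨1, t, t - 1 / 2, fun h0 => ?_, ?_⟩
    · rw [sub_eq_zero.1 h0] at ht
      ring_nf at ht
      norm_num at ht
    · ext i
      fin_cases i <;> simp
      · linear_combination ht
      · linear_combination (t ^ 2 + (y - 2) * t - y / 2) * ht - (t - 1 / 2) * hz
  · obtain rfl : z = -3 / 4 := by
      linear_combination (norm := (simp [tricuspidalEq]; ring)) -h / 4
    refine ⟨1, 1 / 2, 1 / 4, by norm_num, ?_⟩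
    ext i
    fin_cases i <;> norm_num

lemma isReducedEquation_quartic : IsReducedEquation quartic 4 tricuspidalEq :=
  ⟨isHomogeneous_tricuspidalEq,
    squarefree_of_noCommonFactor_grad noCommonFactor_grad_tricuspidalEq, zeroSet_tricuspidalEq⟩

/-- The linear syzygies, as columns, of the partial derivatives of `tricuspidalEq` and one further
cubic. -/
noncomputable def tricuspidalSyzygies : Matrix (Fin 4) (Fin 3) S :=
  !![6 * X 0, 6 * X 0, -12 * X 0 + 6 * X 1;
    4 * X 0 + 2 * X 1, 2 * X 1, 4 * X 1;
    -12 * X 0 - 6 * X 1 - 6 * X 2, -12 * X 1 - 6 * X 2, 0;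
    X 0, X 1, X 2]

lemma isNearlyFreeMatrix_tricuspidalSyzygies :
    IsNearlyFreeMatrix tricuspidalEq 1 (-3) tricuspidalSyzygies where
  isHomogeneous i l := by
    refine isHomogeneous_of_eval_smul fun c v => ?_
    fin_cases i <;> fin_cases l <;> simp [tricuspidalSyzygies] <;> ring
  last_row := by
    ext1 l
    fin_cases l <;> rfl
  ne_zero := by norm_num
  signedMinor_castSucc i := by
    fin_cases i <;>
      simp [signedMinor, tricuspidalSyzygies, grad_tricuspidalEq, det_fin_three, Fin.succAbove,
        ofNat_smul_eq_nsmul] <;> ring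

theorem isNearlyFreeWithExponents_quartic : IsNearlyFreeWithExponents quartic 2 2 :=
  isNearlyFreeMatrix_tricuspidalSyzygies.isNearlyFreeWithExponents
    noCommonFactor_grad_tricuspidalEq isReducedEquation_quartic

/-- The change of coordinates `(x, y, z) ↦ (y - 2x, y, y + z)`, which takes `tricuspidalEq` to
`quarticEq`. -/
noncomputable def quarticCoordinates : (Fin 3 → ℂ) ≃ₗ[ℂ] (Fin 3 → ℂ) where
  toFun v := ![v 1 - 2 * v 0, v 1, v 1 + v 2]
  invFun v := ![(v 1 - v 0) / 2, v 1, v 2 - v 1]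
  map_add' v w := by ext i; fin_cases i <;> simp <;> ring
  map_smul' c v := by ext i; fin_cases i <;> simp <;> ring
  left_inv v := by ext i; fin_cases i <;> simp
  right_inv v := by ext i; fin_cases i <;> simp; ring

lemma projectivelyEquivalent_quartic : ProjectivelyEquivalent quartic (zeroSet quarticEq) := by
  refine ⟨quarticCoordinates, ?_⟩
  rw [← zeroSet_tricuspidalEq]
  refine image_map_zeroSet isHomogeneous_tricuspidalEq isHomogeneous_quarticEq _ fun v => ?_
  simp [quarticCoordinates, quarticEq, tricuspidalEq]
  ring

end TricuspidalQuartic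

end PlaneCurve

theorem corollary4p2 :
    -- the quartic, its equation in suitable coordinates, and the curve with that equation
    (PlaneCurve.IsNearlyFreeWithExponents PlaneCurve.quartic 2 2 ∧
      ∃ C : Set PlaneCurve.P2,
        PlaneCurve.ProjectivelyEquivalent PlaneCurve.quartic C ∧
        PlaneCurve.IsReducedEquation C 4 PlaneCurve.quarticEq ∧
        PlaneCurve.IsNearlyFreeWithExponents C 2 2) ∧
    -- the three quintics
    PlaneCurve.IsFreeWithExponents PlaneCurve.quintic 2 2 ∧
    PlaneCurve.IsFreeWithExponents PlaneCurve.quintic' 2 2 ∧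
    PlaneCurve.IsFreeWithExponents PlaneCurve.quintic'' 2 2 ∧
    -- the equations of two of the quintics
    PlaneCurve.IsReducedEquation PlaneCurve.quintic 5 PlaneCurve.quinticEq ∧
    PlaneCurve.IsReducedEquation PlaneCurve.quintic'' 5 PlaneCurve.quinticEq'' :=
  ⟨⟨PlaneCurve.isNearlyFreeWithExponents_quartic, PlaneCurve.zeroSet PlaneCurve.quarticEq,
      PlaneCurve.projectivelyEquivalent_quartic, PlaneCurve.isReducedEquation_quarticEq,
      PlaneCurve.isNearlyFreeWithExponents_quarticEq⟩,
    PlaneCurve.isFreeWithExponents_quintic, PlaneCurve.isFreeWithExponents_quintic',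
    PlaneCurve.isFreeWithExponents_quintic'', PlaneCurve.isReducedEquation_quintic,
    PlaneCurve.isReducedEquation_quintic''⟩
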